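/- Setting. Types lie in $\Theta=[\underline\theta,\overline\theta]$ and quantities in $X=[0,\overline x]$. A consumer of type $\theta$ who buys quantity $x$ at price $p$ gets utility $v(\theta,x)-p$. The function $v$ is twice continuously differentiable on $\Theta\times X$, concave in $x$, supermodular, satisfies $v(\underline\theta,x)=v(\theta,0)=0$, and is nondecreasing in both arguments, strictly so wherever it is positive. The cost $c:X\to\mathbb R$ is twice differentiable, convex and strictly increasing, with $c(0)=0$. A menu is a compact set $M\subset X\times\mathbb R_+$ with $(0,0)\in M$ such that $(x,0)\in M$ implies $x=0$. Let $(x(\theta),p(\theta))\in\arg\max_{(x,p)\in M}\,(v(\theta,x)-p)$, with ties broken in favor of the firm (i.e. so that $p-c(x)$ is largest). Let $\mathcal F$ be the set of cumulative distribution functions of probability distributions on $\Theta$. Let $BV(\Theta)$ be the space of functions of bounded variation on $\Theta$ with the supremum norm, its elements being extended to $\mathbb R$ by $0$ to the left of $\underline\theta$ and by a constant to the right of $\overline\theta$. For $H\in BV(\Theta)$ put $$\pi(M,H)=\int_\Theta \bigl(p(\theta)-c(x(\theta))\bigr)\,dH(\theta)$$ (Lebesgue--Stieltjes integral, including the mass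 at $\underline\theta$); for $F\in\mathcal F$ this is the expected profit. Theorem. Let $M$ be any menu and $F_0\in\mathcal F$. Let $\theta_1,\theta_2,\dots$ be independent random variables with distribution function $F_0$, and let $\hat F(S^n)(t)=\frac1n\sum_{i=1}^n\mathbf 1\{\theta_i\le t\}$ be the empirical distribution function of $S^n=(\theta_1,\dots,\theta_n)$. Then the functional $\pi(M,\cdot)$ is Fréchet differentiable on $BV(\Theta)$, and its derivative at every point is $\dot\pi_M=\pi(M,\cdot)$. Moreover $$\sqrt n\,\bigl(\pi(M,\hat F(S^n))-\pi(M,F_0)\bigr)\xrightarrow{d}N(0,\sigma^2_{M,F_0}),$$ where, for $\theta\sim F_0$ and $\delta_\theta$ the distribution function of the unit point mass at $\theta$, $$\sigma^2_{M,F_0}=\mathbb E\bigl[(\dot\pi_M(\delta_\theta-F_0))^2\bigr]=\mathbb E\bigl[(\pi(M,\delta_\theta-F_0))^2\bigr]<\infty .$$ If $\sigma^2_{M,F_0}=0$, then $N(0,0)$ is the point mass at $0$. -/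

import Mathlib

open Set Filter Topology MeasureTheory ProbabilityTheory
open scoped ENNReal NNReal

noncomputable section

namespace Screening

/-! ### The normed space of functions of bounded variation on `[a, b]` -/

theorem boundedVariationOn_add {f g : ℝ → ℝ} {s : Set ℝ} (hf : BoundedVariationOn f s)
    (hg : BoundedVariationOn g s) : BoundedVariationOn (f + g) s := by
  have h : eVariationOn (f + g) s ≤ eVariationOn f s + eVariationOn g s := by
    refine iSup_le fun p => ?_
    calc ∑ i ∈ Finset.range p.1, edist ((f + g) (p.2.1 (i + 1))) ((f + g) (p.2.1 i))
        ≤ ∑ i ∈ Finset.range p.1, (edist (f (p.2.1 (i + 1))) (f (p.2.1 i)) +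
            edist (g (p.2.1 (i + 1))) (g (p.2.1 i))) :=
          Finset.sum_le_sum fun i _ => edist_add_add_le _ _ _ _
      _ ≤ _ := by
          rw [Finset.sum_add_distrib]
          exact add_le_add (eVariationOn.sum_le p.2.2.1 p.2.2.2)
            (eVariationOn.sum_le p.2.2.1 p.2.2.2)
  exact ne_top_of_le_ne_top (ENNReal.add_ne_top.2 ⟨hf, hg⟩) h

theorem boundedVariationOn_const (k : ℝ) (s : Set ℝ) :
    BoundedVariationOn (fun _ : ℝ => k) s := by
  have h : eVariationOn (fun _ : ℝ => k) s = 0 :=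
    eVariationOn.constant_on (by rintro _ ⟨x, -, rfl⟩ _ ⟨y, -, rfl⟩; rfl)
  simp [BoundedVariationOn, h]

theorem boundedVariationOn_const_smul {f : ℝ → ℝ} {s : Set ℝ} (k : ℝ)
    (hf : BoundedVariationOn f s) : BoundedVariationOn (k • f) s :=
  (boundedVariationOn_const k s).smul hf

/-- `BV a b` is the space of real functions of bounded variation on `[a, b]` with the supremum
norm. As for cumulative distribution functions, a function on `[a, b]` is regarded as a function
on `ℝ` by extending it by `0` to the left of `a` and by its value at `b` to the right of `b`; this
extension changes neither the supremum norm nor the property of having bounded variation.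
The ambient space `lp (fun _ : ℝ => ℝ) ∞` is the space of all bounded functions `ℝ → ℝ`, with the
supremum norm. -/
def BV (a b : ℝ) : Submodule ℝ (lp (fun _ : ℝ => ℝ) ∞) where
  carrier := {H | BoundedVariationOn (H : ℝ → ℝ) univ ∧ (∀ t < a, H t = 0) ∧ ∀ t ≥ b, H t = H b}
  add_mem' := by
    rintro F G ⟨hF, hF₀, hF₁⟩ ⟨hG, hG₀, hG₁⟩
    refine ⟨boundedVariationOn_add hF hG, fun t ht => ?_, fun t ht => ?_⟩
    · simp [hF₀ t ht, hG₀ t ht]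
    · simp [hF₁ t ht, hG₁ t ht]
  zero_mem' := ⟨boundedVariationOn_const 0 univ, fun _ _ => rfl, fun _ _ => rfl⟩
  smul_mem' := by
    rintro k F ⟨hF, hF₀, hF₁⟩
    refine ⟨boundedVariationOn_const_smul k hF, fun t ht => ?_, fun t ht => ?_⟩
    · simp [hF₀ t ht]
    · simp [hF₁ t ht]

instance (a b : ℝ) : CoeFun (BV a b) (fun _ => ℝ → ℝ) := ⟨fun H => (H : lp (fun _ : ℝ => ℝ) ∞)⟩

theorem BV.boundedVariationOn {a b : ℝ} (H : BV a b) : BoundedVariationOn (fun t => H t) univ :=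
  H.2.1

/-- The norm of `BV a b` is the supremum norm. -/
theorem BV.norm_eq {a b : ℝ} (H : BV a b) : ‖H‖ = ⨆ t : ℝ, |H t| := rfl

/-- The signed Lebesgue--Stieltjes measure `dH` of a function of bounded variation on `[a, b]`,
including the mass of `H` at the left end point `a`. -/
def BV.signedMeasure {a b : ℝ} (H : BV a b) : SignedMeasure ℝ :=
  (BV.boundedVariationOn H).vectorMeasure

/-- The cumulative distribution function of the unit point mass at `θ ∈ [a, b]`. -/
def pointMass {a b : ℝ} (θ : Icc a b) : BV a b :=
  ⟨⟨fun t => if (θ : ℝ) ≤ t then 1 else 0, memℓp_infty ⟨1, by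
      rintro _ ⟨t, rfl⟩
      dsimp only
      split_ifs <;> simp⟩⟩, by
    refine ⟨?_, fun t ht => ?_, fun t ht => ?_⟩
    · refine MonotoneOn.boundedVariationOn (C := 1) (fun s _ t _ hst => ?_) (fun t _ => ?_)
      · dsimp only
        split_ifs with h₁ h₂
        · exact le_rfl
        · exact absurd (h₁.trans hst) h₂
        · exact zero_le_one
        · exact le_rfl
      · dsimp only
        split_ifs <;> simp
    · exact if_neg (not_le.2 (ht.trans_le θ.2.1))
    · exact (if_pos (θ.2.2.trans ht)).trans (if_pos θ.2.2).symm⟩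

theorem pointMass_apply {a b : ℝ} (θ : Icc a b) (t : ℝ) :
    pointMass θ t = if (θ : ℝ) ≤ t then 1 else 0 := rfl

/-- The empirical cumulative distribution function of a sample in `[a, b]`. -/
def empiricalCDF {a b : ℝ} {n : ℕ} (s : Fin n → Icc a b) : BV a b :=
  (n : ℝ)⁻¹ • ∑ i, pointMass (s i)

theorem empiricalCDF_apply {a b : ℝ} {n : ℕ} (s : Fin n → Icc a b) (t : ℝ) :
    empiricalCDF s t = (n : ℝ)⁻¹ * ∑ i, if (s i : ℝ) ≤ t then 1 else 0 := by
  have h : ∀ S : Finset (Fin n), (∑ i ∈ S, pointMass (s i) : BV a b) t =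
      ∑ i ∈ S, if (s i : ℝ) ≤ t then 1 else 0 := by
    intro S
    induction S using Finset.induction_on with
    | empty => rfl
    | insert i S hi ih =>
      rw [Finset.sum_insert hi, Finset.sum_insert hi, ← ih, ← pointMass_apply]
      rfl
  rw [← h, empiricalCDF]
  rfl

/-- `distributions a b` is the set of cumulative distribution functions of probability
distributions on `[a, b]`. (Members of `BV a b` vanish to the left of `a` and are constant to the
right of `b`.) -/
def distributions (a b : ℝ) : Set (BV a b) :=
  {F | Monotone (fun t => F t) ∧ (∀ t, ContinuousWithinAt (fun t => F t) (Ici t) t) ∧ F b = 1}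

/-- A distribution function, viewed as a Stieltjes function. -/
def stieltjes {a b : ℝ} (F : distributions a b) : StieltjesFunction ℝ :=
  ⟨fun t => F.1 t, F.2.1, F.2.2.1⟩

/-- The probability measure on `[a, b]` with cumulative distribution function `F`. -/
def law {a b : ℝ} (F : distributions a b) : Measure (Icc a b) :=
  (stieltjes F).measure.comap Subtype.val

theorem tendsto_atBot {a b : ℝ} (F : distributions a b) : Tendsto (fun t => F.1 t) atBot (𝓝 0) :=
  tendsto_const_nhds.congr' (by
    filter_upwards [eventually_lt_atBot a] with t ht using (F.1.2.2.1 t ht).symm)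

theorem tendsto_atTop {a b : ℝ} (F : distributions a b) : Tendsto (fun t => F.1 t) atTop (𝓝 1) :=
  tendsto_const_nhds.congr' (by
    filter_upwards [eventually_ge_atTop b] with t ht using ((F.1.2.2.2 t ht).trans F.2.2.2).symm)

theorem stieltjes_measure_compl {a b : ℝ} (F : distributions a b) :
    (stieltjes F).measure (Icc a b)ᶜ = 0 := by
  have h : (Icc a b)ᶜ = Iio a ∪ Ioi b := by
    ext t
    simp
    grind
  rw [h]
  refine measure_union_null ?_ ?_
  · rw [StieltjesFunction.measure_Iio _ (tendsto_atBot F)]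
    have h0 : Function.leftLim (stieltjes F) a = 0 := by
      apply leftLim_eq_of_tendsto
      refine tendsto_const_nhds.congr' ?_
      filter_upwards [self_mem_nhdsWithin] with t ht using (F.1.2.2.1 t ht).symm
    simp [h0]
  · rw [StieltjesFunction.measure_Ioi _ (tendsto_atTop F)]
    have h1 : stieltjes F b = 1 := F.2.2.2
    simp [h1]

theorem map_law {a b : ℝ} (F : distributions a b) :
    (law F).map Subtype.val = (stieltjes F).measure := by
  rw [law, (MeasurableEmbedding.subtype_coe measurableSet_Icc).map_comap, Subtype.range_coe]
  exact Measure.restrict_eq_self_of_ae_mem (by rw [ae_iff]; exact stieltjes_measure_compl F)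

instance isProbabilityMeasure_stieltjes {a b : ℝ} (F : distributions a b) :
    IsProbabilityMeasure (stieltjes F).measure :=
  ⟨by rw [StieltjesFunction.measure_univ _ (tendsto_atBot F) (tendsto_atTop F)]; simp⟩

instance isProbabilityMeasure_law {a b : ℝ} (F : distributions a b) :
    IsProbabilityMeasure (law F) := by
  have h : IsProbabilityMeasure ((law F).map Subtype.val) := by rw [map_law]; infer_instance
  exact ⟨by rw [← preimage_univ (f := Subtype.val),
    ← Measure.map_apply measurable_subtype_coe .univ, measure_univ]⟩

/-- For a distribution function, the Lebesgue--Stieltjes measure is the probability distribution. -/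
theorem signedMeasure_eq {a b : ℝ} (F : distributions a b) :
    BV.signedMeasure F.1 = ((law F).map Subtype.val).toSignedMeasure := by
  simp_rw [map_law]
  refine VectorMeasure.ext_of_generateFrom _ ?_
    (borel_eq_generateFrom_Iic ℝ ▸ BorelSpace.measurable_eq) isPiSystem_Iic ?_
  · rintro _ ⟨t, rfl⟩
    rw [BV.signedMeasure, BoundedVariationOn.vectorMeasure_Iic,
      Measure.toSignedMeasure_apply_measurable measurableSet_Iic, (tendsto_atBot F).limUnder_eq,
      (F.2.2.1 t).rightLim_eq, measureReal_def,
      StieltjesFunction.measure_Iic _ (tendsto_atBot F)]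
    have h : 0 ≤ F.1 t := by
      have h' := F.2.1 (show min t (a - 1) ≤ t by simp)
      exact (F.1.2.2.1 _ (show min t (a - 1) < a by simp)).ge.trans h'
    simp [stieltjes, h]
  · rw [BV.signedMeasure, BoundedVariationOn.vectorMeasure_univ,
      Measure.toSignedMeasure_apply_measurable .univ]
    simp [(tendsto_atBot F).limUnder_eq, (tendsto_atTop F).limUnder_eq]

/-! ### The screening environment -/

/-- A screening environment: types `[θlo, θhi]`, quantities `[0, xmax]`, the consumers' valuation
`v θ x` of the quantity `x` and the firm's cost `c x`. -/
structure Environment where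
  θlo : ℝ
  θhi : ℝ
  xmax : ℝ
  v : ℝ → ℝ → ℝ
  c : ℝ → ℝ
  θlo_le_θhi : θlo ≤ θhi
  xmax_nonneg : 0 ≤ xmax
  v_contDiffOn : ContDiffOn ℝ 2 (fun q : ℝ × ℝ => v q.1 q.2) (Icc θlo θhi ×ˢ Icc 0 xmax)
  v_concaveOn : ∀ θ ∈ Icc θlo θhi, ConcaveOn ℝ (Icc 0 xmax) (v θ)
  v_supermodular : ∀ θ ∈ Icc θlo θhi, ∀ θ' ∈ Icc θlo θhi, ∀ x ∈ Icc 0 xmax, ∀ x' ∈ Icc 0 xmax,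
    θ ≤ θ' → x ≤ x' → v θ x' + v θ' x ≤ v θ x + v θ' x'
  v_lowest : ∀ x ∈ Icc 0 xmax, v θlo x = 0
  v_nothing : ∀ θ ∈ Icc θlo θhi, v θ 0 = 0
  v_monotone_type : ∀ x ∈ Icc 0 xmax, MonotoneOn (fun θ => v θ x) (Icc θlo θhi)
  v_monotone_quantity : ∀ θ ∈ Icc θlo θhi, MonotoneOn (v θ) (Icc 0 xmax)
  v_strict_type : ∀ x ∈ Icc 0 xmax, ∀ θ ∈ Icc θlo θhi, ∀ θ' ∈ Icc θlo θhi,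
    0 < v θ x → θ < θ' → v θ x < v θ' x
  v_strict_quantity : ∀ θ ∈ Icc θlo θhi, ∀ x ∈ Icc 0 xmax, ∀ x' ∈ Icc 0 xmax,
    0 < v θ x → x < x' → v θ x < v θ x'
  c_differentiableOn : DifferentiableOn ℝ c (Icc 0 xmax)
  c_differentiableOn_deriv : DifferentiableOn ℝ (derivWithin c (Icc 0 xmax)) (Icc 0 xmax)
  c_convexOn : ConvexOn ℝ (Icc 0 xmax) c
  c_strictMonoOn : StrictMonoOn c (Icc 0 xmax)
  c_zero : c 0 = 0

variable (E : Environment)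

/-- A menu: a compact set of pairs (quantity, price) with nonnegative prices that contains `(0, 0)`
and gives no positive quantity away for free. -/
structure Menu where
  items : Set (ℝ × ℝ)
  isCompact : IsCompact items
  subset : items ⊆ Icc 0 E.xmax ×ˢ Ici 0
  zero_mem : ((0 : ℝ), (0 : ℝ)) ∈ items
  eq_zero_of_free : ∀ x : ℝ, (x, (0 : ℝ)) ∈ items → x = 0

variable {E}

/-- The items of the menu that maximize the utility `v θ x - p` of a consumer of type `θ`. -/
def Menu.demand (M : Menu E) (θ : ℝ) : Set (ℝ × ℝ) :=
  {q | q ∈ M.items ∧ ∀ q' ∈ M.items, E.v θ q'.1 - q'.2 ≤ E.v θ q.1 - q.2}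

/-- The firm's profit `p - c x` from a consumer of type `θ`, who picks an optimal item of the menu,
ties being broken in favor of the firm. -/
def Menu.typeProfit (M : Menu E) (θ : ℝ) : ℝ :=
  sSup ((fun q : ℝ × ℝ => q.2 - E.c q.1) '' M.demand θ)

/-- For every type there is an optimal item that is best for the firm among the optimal items, and
`typeProfit` is the profit from it. -/
theorem Menu.exists_typeProfit_eq (M : Menu E) {θ : ℝ} (hθ : θ ∈ Icc E.θlo E.θhi) :
    ∃ q ∈ M.demand θ, M.typeProfit θ = q.2 - E.c q.1 ∧
      ∀ q' ∈ M.demand θ, q'.2 - E.c q'.1 ≤ q.2 - E.c q.1 := by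
  have hsub : MapsTo Prod.fst M.items (Icc 0 E.xmax) := fun q hq => (M.subset hq).1
  have hv : ContinuousOn (fun q : ℝ × ℝ => E.v θ q.1 - q.2) M.items := by
    refine ContinuousOn.sub ?_ continuousOn_snd
    exact E.v_contDiffOn.continuousOn.comp (f := fun q : ℝ × ℝ => (θ, q.1)) (by fun_prop)
      fun q hq => ⟨hθ, hsub hq⟩
  have hc : ContinuousOn (fun q : ℝ × ℝ => q.2 - E.c q.1) M.items :=
    continuousOn_snd.sub (E.c_differentiableOn.continuousOn.comp continuousOn_fst hsub)
  obtain ⟨q₀, hq₀, hmax⟩ := M.isCompact.exists_isMaxOn ⟨_, M.zero_mem⟩ hv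
  have hD : M.demand θ = M.items ∩ (fun q : ℝ × ℝ => E.v θ q.1 - q.2) ⁻¹'
      Ici (E.v θ q₀.1 - q₀.2) := by
    ext q
    exact ⟨fun h => ⟨h.1, h.2 q₀ hq₀⟩, fun h => ⟨h.1, fun q' hq' => (hmax hq').trans h.2⟩⟩
  have hcomp : IsCompact (M.demand θ) := by
    rw [hD]
    exact M.isCompact.of_isClosed_subset
      (hv.preimage_isClosed_of_isClosed M.isCompact.isClosed isClosed_Ici) inter_subset_left
  obtain ⟨q, hq, hqmax⟩ := hcomp.exists_isMaxOn ⟨q₀, hq₀, fun q' hq' => hmax hq'⟩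
    (hc.mono fun q hq => hq.1)
  refine ⟨q, hq, ?_, fun q' hq' => hqmax hq'⟩
  exact IsGreatest.csSup_eq ⟨mem_image_of_mem _ hq, by rintro _ ⟨q', hq', rfl⟩; exact hqmax hq'⟩

/-- The functional `H ↦ ∫ (p(θ) - c(x(θ))) dH(θ)` (integral over the set of types) on the space of
functions of bounded variation. For a cumulative distribution function `F` it is the expected
profit `π(M, F)`. -/
def profit (M : Menu E) (H : BV E.θlo E.θhi) : ℝ :=
  (BV.signedMeasure H).integral ((Icc E.θlo E.θhi).indicator M.typeProfit)
    (ContinuousLinearMap.lsmul ℝ ℝ).flip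

/-- For a distribution function, `profit` is the expected profit. -/
theorem profit_eq_integral (M : Menu E) (F : distributions E.θlo E.θhi) :
    profit M F.1 = ∫ θ, M.typeProfit θ ∂(law F) := by
  rw [profit, signedMeasure_eq, VectorMeasure.integral_toSignedMeasure,
    integral_indicator measurableSet_Icc,
    (MeasurableEmbedding.subtype_coe measurableSet_Icc).restrict_map,
    (MeasurableEmbedding.subtype_coe measurableSet_Icc).integral_map]
  simp

/-- The asymptotic variance: the expectation, for `θ` distributed according to `F₀`, of the squared
Fréchet derivative of `profit M` at `F₀` in the direction `δ_θ - F₀`. -/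
def asymptoticVariance (M : Menu E) (F₀ : distributions E.θlo E.θhi) : ℝ :=
  ∫ θ, (fderiv ℝ (profit M) F₀.1 (pointMass θ - F₀.1)) ^ 2 ∂(law F₀)

end Screening

end

/-! The functional is linear in `H`, because `dH` is. Differentiability therefore reduces to
continuity in the supremum norm, after which the derivative is the functional itself. Continuity is
the crux: the obvious bound on an integral against `dH` involves the total variation of `H`, which
the supremum norm does not control.

Supermodularity rescues it. Optimal quantities and prices can be selected nondecreasing in the type
(`Menu.exists_monotone_choice`), so the profit per type is a difference of two bounded nondecreasing
functions. The superlevel sets of such a function are intervals, and `dH` gives an interval at most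
`2 * ‖H‖` in absolute value. Slicing the function into layers yields `|∫ f dH| ≤ 2 * K * ‖H‖` when
`0 ≤ f ≤ K` (`BV.abs_integral_le_of_monotoneOn`).

By linearity and `profit_pointMass`, the profit at the empirical distribution is a sample mean of
bounded i.i.d. variables, and the classical central limit theorem applies. -/

namespace Screening

/-! ### Monotone comparative statics of the consumers' choices -/

section Selection

variable {E : Environment}

/-- The optimal items that are best for the firm form a nonempty compact set, so that one of them
has the smallest quantity. -/
theorem Menu.exists_smallest_choice (M : Menu E) {θ : ℝ} (hθ : θ ∈ Icc E.θlo E.θhi) :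
    ∃ q ∈ M.demand θ, M.typeProfit θ = q.2 - E.c q.1 ∧
      ∀ q' ∈ M.demand θ, M.typeProfit θ = q'.2 - E.c q'.1 → q.1 ≤ q'.1 := by
  have hsub : MapsTo Prod.fst M.items (Icc 0 E.xmax) := fun q hq => (M.subset hq).1
  have hv : ContinuousOn (fun q : ℝ × ℝ => E.v θ q.1 - q.2) M.items := by
    refine ContinuousOn.sub ?_ continuousOn_snd
    exact E.v_contDiffOn.continuousOn.comp (f := fun q : ℝ × ℝ => (θ, q.1)) (by fun_prop)
      fun q hq => ⟨hθ, hsub hq⟩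
  have hc : ContinuousOn (fun q : ℝ × ℝ => q.2 - E.c q.1) M.items :=
    continuousOn_snd.sub (E.c_differentiableOn.continuousOn.comp continuousOn_fst hsub)
  obtain ⟨q₀, hq₀, hq₀', -⟩ := M.exists_typeProfit_eq hθ
  -- The firm's favorites form a level set of the continuous map (utility, profit), hence a compact
  -- set.
  have hO : {q | q ∈ M.demand θ ∧ M.typeProfit θ = q.2 - E.c q.1} = M.items ∩
      (fun q : ℝ × ℝ => (E.v θ q.1 - q.2, q.2 - E.c q.1)) ⁻¹'
        {(E.v θ q₀.1 - q₀.2, M.typeProfit θ)} := by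
    ext q
    constructor
    · rintro ⟨h, h'⟩
      exact ⟨h.1, Prod.ext (le_antisymm (hq₀.2 q h.1) (h.2 q₀ hq₀.1)) h'.symm⟩
    · rintro ⟨h, h'⟩
      obtain ⟨h₁, h₂⟩ := Prod.ext_iff.1 h'
      exact ⟨⟨h, fun q' hq' => (hq₀.2 q' hq').trans h₁.ge⟩, h₂.symm⟩
  have hcomp : IsCompact {q | q ∈ M.demand θ ∧ M.typeProfit θ = q.2 - E.c q.1} := by
    rw [hO]
    exact M.isCompact.of_isClosed_subset
      ((hv.prodMk hc).preimage_isClosed_of_isClosed M.isCompact.isClosed isClosed_singleton)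
      inter_subset_left
  obtain ⟨q, hq, hqmin⟩ := hcomp.exists_isMinOn ⟨q₀, hq₀, hq₀'⟩ continuousOn_fst
  exact ⟨q, hq.1, hq.2, fun q' h h' => hqmin ⟨h, h'⟩⟩

/-- If a higher type demands a smaller quantity, then both types are indifferent between their
choices. -/
theorem Menu.mem_demand_of_le (M : Menu E) {θ θ' : ℝ} (hθ : θ ∈ Icc E.θlo E.θhi)
    (hθ' : θ' ∈ Icc E.θlo E.θhi) (h : θ ≤ θ') {q q' : ℝ × ℝ} (hq : q ∈ M.demand θ)
    (hq' : q' ∈ M.demand θ') (hlt : q'.1 ≤ q.1) : q' ∈ M.demand θ ∧ q ∈ M.demand θ' := by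
  have h₁ := hq.2 q' hq'.1
  have h₂ := hq'.2 q hq.1
  -- The two optimality inequalities add up to the reverse of this one, so all three are equalities.
  have h₃ := E.v_supermodular θ hθ θ' hθ' q'.1 (M.subset hq'.1).1 q.1 (M.subset hq.1).1 h hlt
  exact ⟨⟨hq'.1, fun r hr => (hq.2 r hr).trans (by linarith)⟩,
    ⟨hq.1, fun r hr => (hq'.2 r hr).trans (by linarith)⟩⟩

/-- Quantities and prices that are optimal for the consumers, with ties broken in favor of the
firm, can be chosen nondecreasing in the type. -/
theorem Menu.exists_monotone_choice (M : Menu E) :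
    ∃ x p : ℝ → ℝ, MonotoneOn x (Icc E.θlo E.θhi) ∧ MonotoneOn p (Icc E.θlo E.θhi) ∧
      ∀ θ ∈ Icc E.θlo E.θhi, (x θ, p θ) ∈ M.items ∧ M.typeProfit θ = p θ - E.c (x θ) := by
  have hex : ∀ θ : ℝ, ∃ q : ℝ × ℝ, θ ∈ Icc E.θlo E.θhi →
      q ∈ M.demand θ ∧ M.typeProfit θ = q.2 - E.c q.1 ∧
        ∀ q' ∈ M.demand θ, M.typeProfit θ = q'.2 - E.c q'.1 → q.1 ≤ q'.1 := by
    intro θ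
    by_cases hθ : θ ∈ Icc E.θlo E.θhi
    · obtain ⟨q, h⟩ := M.exists_smallest_choice hθ
      exact ⟨q, fun _ => h⟩
    · exact ⟨0, fun h => absurd h hθ⟩
  choose q hq using hex
  have hx : MonotoneOn (fun θ => (q θ).1) (Icc E.θlo E.θhi) := by
    intro θ hθ θ' hθ' h
    -- If the quantity dropped, each item would be optimal for both types. Tie-breaking at `θ` and
    -- at `θ'` then makes them equally profitable, so the smaller one competes at `θ`, against
    -- minimality.
    by_contra! hlt
    obtain ⟨hd, hp, hmin⟩ := hq θ hθ
    obtain ⟨hd', hp', -⟩ := hq θ' hθ'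
    obtain ⟨h₁, h₂⟩ := M.mem_demand_of_le hθ hθ' h hd hd' hlt.le
    obtain ⟨r, -, hr, hrmax⟩ := M.exists_typeProfit_eq hθ
    obtain ⟨r', -, hr', hrmax'⟩ := M.exists_typeProfit_eq hθ'
    have h₃ := hrmax _ h₁
    have h₄ := hrmax' _ h₂
    exact absurd (hmin _ h₁ (by linarith)) (not_le.2 hlt)
  refine ⟨fun θ => (q θ).1, fun θ => (q θ).2, hx, fun θ hθ θ' hθ' h => ?_,
    fun θ hθ => ⟨(hq θ hθ).1.1, (hq θ hθ).2.1⟩⟩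
  have hd := (hq θ hθ).1
  have hd' := (hq θ' hθ').1
  -- Type `θ` declines the larger quantity of `θ'`, so the price difference is at least its
  -- nonnegative gain in value.
  have h₁ := hd.2 _ hd'.1
  have h₂ := E.v_monotone_quantity θ hθ (M.subset hd.1).1 (M.subset hd'.1).1 (hx hθ hθ' h)
  dsimp only
  linarith

/-- The profit from a type is a difference of nonnegative nondecreasing functions of the type. -/
theorem Menu.exists_typeProfit_eq_sub (M : Menu E) :
    ∃ f g : ℝ → ℝ, MonotoneOn f (Icc E.θlo E.θhi) ∧ MonotoneOn g (Icc E.θlo E.θhi) ∧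
      (∀ θ ∈ Icc E.θlo E.θhi, 0 ≤ f θ) ∧ (∀ θ ∈ Icc E.θlo E.θhi, 0 ≤ g θ) ∧
      ∀ θ ∈ Icc E.θlo E.θhi, M.typeProfit θ = f θ - g θ := by
  obtain ⟨x, p, hx, hp, h⟩ := M.exists_monotone_choice
  have hxmem : ∀ θ ∈ Icc E.θlo E.θhi, x θ ∈ Icc 0 E.xmax := fun θ hθ => (M.subset (h θ hθ).1).1
  refine ⟨p, fun θ => E.c (x θ), hp, fun θ hθ θ' hθ' hle => ?_,
    fun θ hθ => (M.subset (h θ hθ).1).2, fun θ hθ => ?_, fun θ hθ => (h θ hθ).2⟩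
  · exact E.c_strictMonoOn.monotoneOn (hxmem θ hθ) (hxmem θ' hθ') (hx hθ hθ' hle)
  · rw [← E.c_zero]
    exact E.c_strictMonoOn.monotoneOn ⟨le_rfl, E.xmax_nonneg⟩ (hxmem θ hθ) (hxmem θ hθ).1

end Selection

end Screening

namespace Screening

/-! ### Stieltjes integrals of monotone functions and the supremum norm -/

section StieltjesIntegral

variable {a b : ℝ}

theorem BV.abs_apply_le (H : BV a b) (t : ℝ) : |H t| ≤ ‖H‖ :=
  lp.norm_apply_le_norm (by simp) (H : lp (fun _ : ℝ => ℝ) ∞) t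

theorem BV.abs_le_of_tendsto (H : BV a b) {l : Filter ℝ} [l.NeBot] {y : ℝ}
    (h : Tendsto (fun t => H t) l (𝓝 y)) : |y| ≤ ‖H‖ :=
  le_of_tendsto h.abs (Eventually.of_forall (BV.abs_apply_le H))

/-- Half-lines `Iic t` together with `univ` determine a signed measure. On these sets `dH` is a
difference of limits of `H`, and limits are additive. -/
theorem BV.signedMeasure_add (F G : BV a b) :
    BV.signedMeasure (F + G) = BV.signedMeasure F + BV.signedMeasure G := by
  have hF := BV.boundedVariationOn F
  have hG := BV.boundedVariationOn G
  refine VectorMeasure.ext_of_generateFrom _ ?_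
    (borel_eq_generateFrom_Iic ℝ ▸ BorelSpace.measurable_eq) isPiSystem_Iic ?_
  · rintro _ ⟨t, rfl⟩
    have h₁ := tendsto_nhds_unique ((BV.boundedVariationOn (F + G)).tendsto_rightLim t)
      ((hF.tendsto_rightLim t).add (hG.tendsto_rightLim t))
    have h₂ := tendsto_nhds_unique (BV.boundedVariationOn (F + G)).tendsto_atBot_limUnder
      (hF.tendsto_atBot_limUnder.add hG.tendsto_atBot_limUnder)
    rw [_root_.add_apply]
    simp only [BV.signedMeasure, BoundedVariationOn.vectorMeasure_Iic, h₁, h₂]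
    ring
  · have h₁ := tendsto_nhds_unique (BV.boundedVariationOn (F + G)).tendsto_atTop_limUnder
      (hF.tendsto_atTop_limUnder.add hG.tendsto_atTop_limUnder)
    have h₂ := tendsto_nhds_unique (BV.boundedVariationOn (F + G)).tendsto_atBot_limUnder
      (hF.tendsto_atBot_limUnder.add hG.tendsto_atBot_limUnder)
    rw [_root_.add_apply]
    simp only [BV.signedMeasure, BoundedVariationOn.vectorMeasure_univ, h₁, h₂]
    ring

theorem BV.signedMeasure_smul (k : ℝ) (F : BV a b) :
    BV.signedMeasure (k • F) = k • BV.signedMeasure F := by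
  have hF := BV.boundedVariationOn F
  refine VectorMeasure.ext_of_generateFrom _ ?_
    (borel_eq_generateFrom_Iic ℝ ▸ BorelSpace.measurable_eq) isPiSystem_Iic ?_
  · rintro _ ⟨t, rfl⟩
    have h₁ := tendsto_nhds_unique ((BV.boundedVariationOn (k • F)).tendsto_rightLim t)
      ((hF.tendsto_rightLim t).const_mul k)
    have h₂ := tendsto_nhds_unique (BV.boundedVariationOn (k • F)).tendsto_atBot_limUnder
      (hF.tendsto_atBot_limUnder.const_mul k)
    rw [_root_.smul_apply]
    simp only [BV.signedMeasure, BoundedVariationOn.vectorMeasure_Iic, h₁, h₂, smul_eq_mul]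
    ring
  · have h₁ := tendsto_nhds_unique (BV.boundedVariationOn (k • F)).tendsto_atTop_limUnder
      (hF.tendsto_atTop_limUnder.const_mul k)
    have h₂ := tendsto_nhds_unique (BV.boundedVariationOn (k • F)).tendsto_atBot_limUnder
      (hF.tendsto_atBot_limUnder.const_mul k)
    rw [_root_.smul_apply]
    simp only [BV.signedMeasure, BoundedVariationOn.vectorMeasure_univ, h₁, h₂, smul_eq_mul]
    ring

/-- The Lebesgue--Stieltjes measure of an interval is at most twice the supremum norm. -/
theorem BV.abs_signedMeasure_le (H : BV a b) {S : Set ℝ} (hS : S.OrdConnected) :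
    |BV.signedMeasure H S| ≤ 2 * ‖H‖ := by
  have hH := BV.boundedVariationOn H
  have hsub : ∀ y z : ℝ, |y| ≤ ‖H‖ → |z| ≤ ‖H‖ → |y - z| ≤ 2 * ‖H‖ := fun y z hy hz =>
    (abs_sub y z).trans (by linarith)
  have hl := fun t => BV.abs_le_of_tendsto H (hH.tendsto_leftLim t)
  have hr := fun t => BV.abs_le_of_tendsto H (hH.tendsto_rightLim t)
  have hbot := BV.abs_le_of_tendsto H hH.tendsto_atBot_limUnder
  have htop := BV.abs_le_of_tendsto H hH.tendsto_atTop_limUnder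
  have hempty : |BV.signedMeasure H ∅| ≤ 2 * ‖H‖ := by simp
  rw [BV.signedMeasure] at hempty ⊢
  generalize hs : sInf S = s
  generalize ht : sSup S = t
  rcases hS.isPreconnected.mem_intervals with
    -- In each nonempty case the mass is a difference of two one-sided limits or limits at infinity,
    -- each bounded by `‖H‖`.
    (h | h | h | h | h | h | h | h | h | h) <;> rw [h] <;> try rw [hs]
  all_goals try rw [ht]
  · rcases le_or_gt s t with hst | hst
    · rw [hH.vectorMeasure_Icc hst]; exact hsub _ _ (hr _) (hl _)
    · rwa [Icc_eq_empty hst.not_ge]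
  · rcases le_or_gt s t with hst | hst
    · rw [hH.vectorMeasure_Ico hst]; exact hsub _ _ (hl _) (hl _)
    · rwa [Ico_eq_empty hst.not_gt]
  · rcases le_or_gt s t with hst | hst
    · rw [hH.vectorMeasure_Ioc hst]; exact hsub _ _ (hr _) (hr _)
    · rwa [Ioc_eq_empty hst.not_gt]
  -- Strict inequality is needed here: for `s = t` the interval is empty, but left limit minus right
  -- limit need not vanish.
  · rcases lt_or_ge s t with hst | hst
    · rw [hH.vectorMeasure_Ioo hst]; exact hsub _ _ (hl _) (hr _)
    · rwa [Ioo_eq_empty hst.not_gt]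
  · rw [hH.vectorMeasure_Ici]; exact hsub _ _ htop (hl _)
  · rw [hH.vectorMeasure_Ioi]; exact hsub _ _ htop (hr _)
  · rw [hH.vectorMeasure_Iic]; exact hsub _ _ (hr _) hbot
  · rw [hH.vectorMeasure_Iio]; exact hsub _ _ (hl _) hbot
  · rw [hH.vectorMeasure_univ]; exact hsub _ _ htop hbot
  · exact hempty

instance isFiniteMeasure_variation {X : Type*} [MeasurableSpace X] (μ : SignedMeasure X) :
    IsFiniteMeasure (VectorMeasure.variation μ) := by
  rw [← SignedMeasure.totalVariation_eq_variation]
  infer_instance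

/-- Rounding `y` down to a multiple of `ε`, as a sum of indicators of upper sets. -/
theorem sum_indicator_Ici_approx {ε y : ℝ} (hε : 0 ≤ ε) (hy : 0 ≤ y) (N : ℕ) :
    let S := ∑ k ∈ Finset.range N, (Ici ((k + 1) * ε)).indicator (fun _ => ε) y
    (N * ε ≤ y → S = N * ε) ∧ (y ≤ N * ε → |y - S| ≤ ε) := by
  -- The first conjunct, saturation of the first `N` layers, feeds the step when `y` lies between `N
  -- * ε` and `(N + 1) * ε`.
  induction N with
  | zero =>
    simp only [Finset.range_zero, Finset.sum_empty, Nat.cast_zero, zero_mul]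
    exact ⟨fun _ => trivial, fun h => by simpa [le_antisymm h hy] using hε⟩
  | succ N ih =>
    obtain ⟨ih₁, ih₂⟩ := ih
    simp only [Finset.sum_range_succ, Nat.cast_succ] at *
    by_cases h : ((N : ℝ) + 1) * ε ≤ y
    · rw [ih₁ (by linarith), indicator_of_mem (mem_Ici.2 h)]
      refine ⟨fun _ => by ring, fun h' => ?_⟩
      have : y - (N * ε + ε) = 0 := by linarith
      simpa [this] using hε
    · rw [indicator_of_notMem (by simpa using h), add_zero]
      refine ⟨fun h' => absurd h' h, fun _ => ?_⟩
      rcases le_total y (N * ε) with h' | h'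
      · exact ih₂ h'
      · rw [ih₁ h', abs_of_nonneg (by linarith)]
        linarith

theorem measurable_indicator_of_monotoneOn {f : ℝ → ℝ} (hf : MonotoneOn f (Icc a b)) :
    Measurable ((Icc a b).indicator f) := by
  refine measurable_of_restrict_of_restrict_compl (s := Icc a b) measurableSet_Icc ?_ ?_
  · have h : (Icc a b).domRestrict ((Icc a b).indicator f) = fun t : Icc a b => f t :=
      funext fun t => indicator_of_mem t.2 f
    rw [h]
    exact Monotone.measurable fun s t hst => hf s.2 t.2 hst
  · have h : (Icc a b)ᶜ.domRestrict ((Icc a b).indicator f) = fun _ => 0 :=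
      funext fun t => indicator_of_notMem t.2 f
    rw [h]
    exact measurable_const

theorem BV.integrable_of_bounded (H : BV a b) {f : ℝ → ℝ} (hf : Measurable f) {C : ℝ}
    (hC : ∀ t, |f t| ≤ C) : VectorMeasure.Integrable (BV.signedMeasure H) f :=
  Integrable.of_bound hf.aestronglyMeasurable C (Eventually.of_forall hC)

/-- The Lebesgue--Stieltjes integral of a monotone function is continuous in the integrator with
respect to the supremum norm. -/
theorem BV.abs_integral_le_of_monotoneOn (H : BV a b) {f : ℝ → ℝ} (hf : MonotoneOn f (Icc a b))
    {K : ℝ} (hK : ∀ t ∈ Icc a b, f t ∈ Icc 0 K) (hK₀ : 0 ≤ K) :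
    |(BV.signedMeasure H).integral ((Icc a b).indicator f) (ContinuousLinearMap.lsmul ℝ ℝ).flip| ≤
      2 * K * ‖H‖ := by
  set B := (ContinuousLinearMap.lsmul ℝ ℝ (E := ℝ)).flip
  set μ := BV.signedMeasure H
  -- The total variation enters only through the discretization error. It is finite for the fixed
  -- `H`, so this term vanishes as `n` grows.
  have key : ∀ n : ℕ, |μ.integral ((Icc a b).indicator f) B| ≤
      2 * K * ‖H‖ + K * ‖B‖ * μ.variation.real univ * (1 / ((n : ℝ) + 1)) := by
    intro n
    set ε := K * (1 / ((n : ℝ) + 1)) with hε_def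
    have hε : 0 ≤ ε := by positivity
    have hNε : ((n + 1 : ℕ) : ℝ) * ε = K := by
      rw [hε_def]; push_cast; field_simp
    let S : ℕ → Set ℝ := fun k => Icc a b ∩ {t | ((k : ℝ) + 1) * ε ≤ f t}
    have hS : ∀ k, (S k).OrdConnected := fun k => ⟨fun s hs t ht u hu =>
      have hu' : u ∈ Icc a b := ⟨hs.1.1.trans hu.1, hu.2.trans ht.1.2⟩
      ⟨hu', le_trans hs.2 (hf hs.1 hu' hu.1)⟩⟩
    let s : ℕ → ℝ → ℝ := fun k => (S k).indicator fun _ => ε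
    have hsm : ∀ k, Measurable (s k) := fun k => measurable_const.indicator (hS k).measurableSet
    have hsi : ∀ k ∈ Finset.range (n + 1), VectorMeasure.Integrable μ (s k) := fun k _ =>
      BV.integrable_of_bounded H (hsm k) (C := ε) fun t => by
        simp only [s, indicator]; split_ifs <;> simp [abs_of_nonneg, hε]
    have hfi : VectorMeasure.Integrable μ ((Icc a b).indicator f) :=
      BV.integrable_of_bounded H (measurable_indicator_of_monotoneOn hf) (C := K) fun t => by
        by_cases ht : t ∈ Icc a b
        · rw [indicator_of_mem ht, abs_of_nonneg (hK t ht).1]; exact (hK t ht).2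
        · simpa [indicator_of_notMem ht] using hK₀
    have hclose : ∀ t, ‖((Icc a b).indicator f - ∑ k ∈ Finset.range (n + 1), s k) t‖ ≤ ε := by
      intro t
      rw [Pi.sub_apply, Finset.sum_apply, Real.norm_eq_abs]
      by_cases ht : t ∈ Icc a b
      · rw [indicator_of_mem ht]
        have h := (sum_indicator_Ici_approx hε (hK t ht).1 (n + 1)).2
          ((hK t ht).2.trans hNε.ge)
        convert h using 4 with k _
        simp only [s, S, indicator, mem_inter_iff, ht, true_and, mem_ofPred_eq, mem_Ici]
      · have : ∀ k, s k t = 0 := fun k => indicator_of_notMem (fun h => ht h.1) _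
        simpa [indicator_of_notMem ht, this] using hε
    have hsum : μ.integral (∑ k ∈ Finset.range (n + 1), s k) B =
        ∑ k ∈ Finset.range (n + 1), ε * μ (S k) := by
      have := VectorMeasure.integral_finsetSum (B := B) (Finset.range (n + 1)) hsi
      have e : (∑ k ∈ Finset.range (n + 1), s k) =
        fun t => ∑ k ∈ Finset.range (n + 1), s k t := by ext; simp
      rw [e, this]
      refine Finset.sum_congr rfl fun k _ => ?_
      rw [VectorMeasure.integral_indicator_const ε (hS k).measurableSet]
      simp [B, mul_comm]
    -- There are `n + 1` layers of height `ε = K / (n + 1)`, so the bound does not depend on `n`.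
    have hsum_le : |∑ k ∈ Finset.range (n + 1), ε * μ (S k)| ≤ 2 * K * ‖H‖ := by
      calc _ ≤ ∑ k ∈ Finset.range (n + 1), |ε * μ (S k)| := Finset.abs_sum_le_sum_abs _ _
        _ ≤ ∑ k ∈ Finset.range (n + 1), ε * (2 * ‖H‖) := by
          refine Finset.sum_le_sum fun k _ => ?_
          rw [abs_mul, abs_of_nonneg hε]
          exact mul_le_mul_of_nonneg_left (BV.abs_signedMeasure_le H (hS k)) hε
        _ = 2 * K * ‖H‖ := by
          rw [Finset.sum_const, Finset.card_range, nsmul_eq_mul, ← mul_assoc, hNε]; ring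
    have hdiff := VectorMeasure.norm_integral_le_of_norm_le_const (μ := μ) (B := B)
      (Eventually.of_forall hclose)
    rw [VectorMeasure.integral_sub hfi (integrable_finsetSum' _ hsi), hsum, Real.norm_eq_abs]
      at hdiff
    have := abs_sub_abs_le_abs_sub (μ.integral ((Icc a b).indicator f) B)
      (∑ k ∈ Finset.range (n + 1), ε * μ (S k))
    have e : K * ‖B‖ * μ.variation.real univ * (1 / ((n : ℝ) + 1)) =
      ε * ‖B‖ * μ.variation.real univ := by rw [hε_def]; ring
    linarith
  have hlim : Tendsto (fun n : ℕ => 2 * K * ‖H‖ +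
      K * ‖B‖ * μ.variation.real univ * (1 / ((n : ℝ) + 1))) atTop (𝓝 (2 * K * ‖H‖)) := by
    simpa using (tendsto_one_div_add_atTop_nhds_zero_nat (𝕜 := ℝ)).const_mul
      (K * ‖B‖ * μ.variation.real univ) |>.const_add (2 * K * ‖H‖)
  exact ge_of_tendsto' hlim key

end StieltjesIntegral

end Screening

namespace Screening

/-! ### The profit functional as a continuous linear functional -/

section Profit

variable {E : Environment}

theorem Menu.measurable_indicator_typeProfit (M : Menu E) :
    Measurable ((Icc E.θlo E.θhi).indicator M.typeProfit) := by
  obtain ⟨f, g, hf, hg, -, -, h⟩ := M.exists_typeProfit_eq_sub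
  have e : (Icc E.θlo E.θhi).indicator M.typeProfit =
      (Icc E.θlo E.θhi).indicator f - (Icc E.θlo E.θhi).indicator g := by
    rw [← indicator_sub']
    exact indicator_congr h
  rw [e]
  exact (measurable_indicator_of_monotoneOn hf).sub (measurable_indicator_of_monotoneOn hg)

theorem Menu.exists_abs_typeProfit_le (M : Menu E) :
    ∃ C, 0 ≤ C ∧ ∀ θ ∈ Icc E.θlo E.θhi, |M.typeProfit θ| ≤ C := by
  obtain ⟨f, g, hf, hg, hf₀, hg₀, h⟩ := M.exists_typeProfit_eq_sub
  have hhi : E.θhi ∈ Icc E.θlo E.θhi := right_mem_Icc.2 E.θlo_le_θhi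
  refine ⟨f E.θhi + g E.θhi, add_nonneg (hf₀ _ hhi) (hg₀ _ hhi), fun θ hθ => ?_⟩
  rw [h θ hθ, abs_le]
  have := hf₀ θ hθ
  have := hg₀ θ hθ
  have := hf hθ hhi hθ.2
  have := hg hθ hhi hθ.2
  constructor <;> linarith

theorem Menu.measurable_typeProfit (M : Menu E) :
    Measurable fun τ : Icc E.θlo E.θhi => M.typeProfit τ := by
  have h := M.measurable_indicator_typeProfit.comp
    (measurable_subtype_coe : Measurable (Subtype.val : Icc E.θlo E.θhi → ℝ))
  convert h using 1
  exact funext fun τ => (indicator_of_mem τ.2 _).symm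

theorem Menu.integrable_typeProfit (M : Menu E) (H : BV E.θlo E.θhi) :
    VectorMeasure.Integrable (BV.signedMeasure H)
      ((Icc E.θlo E.θhi).indicator M.typeProfit) := by
  obtain ⟨C, hC₀, hC⟩ := M.exists_abs_typeProfit_le
  refine BV.integrable_of_bounded H M.measurable_indicator_typeProfit (C := C) fun t => ?_
  by_cases ht : t ∈ Icc E.θlo E.θhi
  · rw [indicator_of_mem ht]
    exact hC t ht
  · simpa [indicator_of_notMem ht] using hC₀

theorem profit_add (M : Menu E) (F G : BV E.θlo E.θhi) :
    profit M (F + G) = profit M F + profit M G := by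
  rw [profit, BV.signedMeasure_add, VectorMeasure.integral_add_vectorMeasure
    (M.integrable_typeProfit F) (M.integrable_typeProfit G)]
  rfl

theorem profit_smul (M : Menu E) (k : ℝ) (F : BV E.θlo E.θhi) :
    profit M (k • F) = k * profit M F := by
  rw [profit, BV.signedMeasure_smul, VectorMeasure.integral_smul_vectorMeasure]
  rfl

/-- Each monotone part of the profit is bounded by its value at the highest type, which gives the
constant. This is the continuity behind Fréchet differentiability. -/
theorem exists_abs_profit_le (M : Menu E) : ∃ C, ∀ H, |profit M H| ≤ C * ‖H‖ := by
  obtain ⟨f, g, hf, hg, hf₀, hg₀, h⟩ := M.exists_typeProfit_eq_sub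
  have hhi : E.θhi ∈ Icc E.θlo E.θhi := right_mem_Icc.2 E.θlo_le_θhi
  have e : (Icc E.θlo E.θhi).indicator M.typeProfit =
      (Icc E.θlo E.θhi).indicator f - (Icc E.θlo E.θhi).indicator g := by
    rw [← indicator_sub']
    exact indicator_congr h
  have hint : ∀ (H : BV E.θlo E.θhi) {f : ℝ → ℝ}, MonotoneOn f (Icc E.θlo E.θhi) →
      (∀ θ ∈ Icc E.θlo E.θhi, 0 ≤ f θ) →
      VectorMeasure.Integrable (BV.signedMeasure H) ((Icc E.θlo E.θhi).indicator f) := by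
    intro H f hf hf₀
    refine BV.integrable_of_bounded H (measurable_indicator_of_monotoneOn hf) (C := f E.θhi)
      fun t => ?_
    by_cases ht : t ∈ Icc E.θlo E.θhi
    · rw [indicator_of_mem ht, abs_of_nonneg (hf₀ t ht)]
      exact hf ht hhi ht.2
    · simpa [indicator_of_notMem ht] using hf₀ _ hhi
  refine ⟨2 * f E.θhi + 2 * g E.θhi, fun H => ?_⟩
  rw [profit, e, VectorMeasure.integral_sub (hint H hf hf₀) (hint H hg hg₀), add_mul]
  exact (abs_sub _ _).trans (add_le_add
    (BV.abs_integral_le_of_monotoneOn H hf (fun t ht => ⟨hf₀ t ht, hf ht hhi ht.2⟩) (hf₀ _ hhi))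
    (BV.abs_integral_le_of_monotoneOn H hg (fun t ht => ⟨hg₀ t ht, hg ht hhi ht.2⟩) (hg₀ _ hhi)))

/-- The functional `profit M` as a continuous linear functional on the space of functions of
bounded variation with the supremum norm. -/
noncomputable def profitCLM (M : Menu E) : BV E.θlo E.θhi →L[ℝ] ℝ :=
  LinearMap.mkContinuousOfExistsBound
    { toFun := profit M
      map_add' := profit_add M
      map_smul' := profit_smul M }
    (exists_abs_profit_le M)

theorem coe_profitCLM (M : Menu E) : ⇑(profitCLM M) = profit M := rfl

theorem fderiv_profit (M : Menu E) (F : BV E.θlo E.θhi) :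
    fderiv ℝ (profit M) F = profitCLM M :=
  (profitCLM M).fderiv

/-- Half-lines determine a probability measure on `ℝ`, and the embedding of `Icc a b` transfers this
back. It serves both for Dirac masses and for the law of the observations. -/
theorem law_eq_of_real_le {a b : ℝ} (F : distributions a b) (ν : Measure (Icc a b))
    [IsProbabilityMeasure ν] (h : ∀ t, ν.real {τ | (τ : ℝ) ≤ t} = F.1 t) : ν = law F := by
  have hmap : ν.map Subtype.val = (law F).map Subtype.val := by
    have := Measure.isProbabilityMeasure_map (μ := ν)
      (measurable_subtype_coe (p := (· ∈ Icc a b))).aemeasurable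
    rw [map_law]
    refine Measure.ext_of_Iic _ _ fun t => ?_
    rw [Measure.map_apply measurable_subtype_coe measurableSet_Iic,
      StieltjesFunction.measure_Iic _ (tendsto_atBot F), sub_zero]
    have : stieltjes F t = ν.real {τ | (τ : ℝ) ≤ t} := (h t).symm
    rw [this, ofReal_measureReal]
    rfl
  have he := MeasurableEmbedding.subtype_coe (measurableSet_Icc (a := a) (b := b))
  rw [← he.comap_map ν, hmap, he.comap_map]

theorem pointMass_mem_distributions {a b : ℝ} (τ : Icc a b) :
    pointMass τ ∈ distributions a b := by
  refine ⟨fun s t hst => ?_, fun t => ?_, if_pos τ.2.2⟩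
  · simp only [pointMass_apply]
    split_ifs with h₁ h₂
    · exact le_rfl
    · exact absurd (h₁.trans hst) h₂
    · exact zero_le_one
    · exact le_rfl
  · simp only [pointMass_apply]
    by_cases h : (τ : ℝ) ≤ t
    · refine (continuousWithinAt_const (b := (1 : ℝ))).congr (fun s hs => if_pos (h.trans hs))
        (if_pos h)
    · have : (fun s : ℝ => if (τ : ℝ) ≤ s then (1 : ℝ) else 0) =ᶠ[𝓝 t] fun _ => 0 := by
        filter_upwards [Iio_mem_nhds (not_le.1 h)] with s hs using if_neg (not_le.2 hs)
      exact (continuousAt_const.congr this.symm).continuousWithinAt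

/-- The law attached to `pointMass τ` is the Dirac measure at `τ`. Up to centering, the profit per
type is thus the influence function. -/
theorem profit_pointMass (M : Menu E) (τ : Icc E.θlo E.θhi) :
    profit M (pointMass τ) = M.typeProfit τ := by
  have h := profit_eq_integral M ⟨pointMass τ, pointMass_mem_distributions τ⟩
  rw [← law_eq_of_real_le _ (Measure.dirac τ)] at h
  · exact h.trans (integral_dirac _ _)
  · intro t
    have hm : MeasurableSet {σ : Icc E.θlo E.θhi | (σ : ℝ) ≤ t} :=
      measurable_subtype_coe measurableSet_Iic
    rw [measureReal_def, Measure.dirac_apply' _ hm, pointMass_apply, indicator_apply]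
    simp only [mem_ofPred_eq]
    split_ifs <;> simp

theorem profit_pointMass_sub (M : Menu E) (τ : Icc E.θlo E.θhi) (F : BV E.θlo E.θhi) :
    profit M (pointMass τ - F) = M.typeProfit τ - profit M F := by
  rw [← profit_pointMass, ← coe_profitCLM, map_sub]

theorem profit_empiricalCDF (M : Menu E) {n : ℕ} (s : Fin n → Icc E.θlo E.θhi) :
    profit M (empiricalCDF s) = (n : ℝ)⁻¹ * ∑ i, M.typeProfit (s i) := by
  simp_rw [← profit_pointMass, ← coe_profitCLM, empiricalCDF, map_smul, map_sum, smul_eq_mul]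

theorem Menu.memLp_typeProfit (M : Menu E) (ν : Measure (Icc E.θlo E.θhi)) [IsFiniteMeasure ν]
    (p : ℝ≥0∞) : MemLp (fun τ : Icc E.θlo E.θhi => M.typeProfit τ) p ν := by
  obtain ⟨C, -, hC⟩ := M.exists_abs_typeProfit_le
  exact .of_bound M.measurable_typeProfit.aestronglyMeasurable C
    (Eventually.of_forall fun τ => hC τ τ.2)

theorem asymptoticVariance_eq_variance (M : Menu E) (F : distributions E.θlo E.θhi) :
    asymptoticVariance M F = Var[fun τ : Icc E.θlo E.θhi => M.typeProfit τ; law F] := by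
  rw [variance_eq_integral M.measurable_typeProfit.aemeasurable, ← profit_eq_integral]
  simp_rw [asymptoticVariance, fderiv_profit, coe_profitCLM, profit_pointMass_sub]

end Profit

end Screening

/-! ### Differentiability and the central limit theorem -/

theorem mainTheorem5 (E : Screening.Environment) (M : Screening.Menu E)
    (F₀ : Screening.distributions E.θlo E.θhi)
    {Ω : Type*} [MeasurableSpace Ω] (P : Measure Ω) [IsProbabilityMeasure P]
    (θ : ℕ → Ω → Icc E.θlo E.θhi) (hθ_meas : ∀ i, Measurable (θ i)) (hθ_indep : iIndepFun θ P)
    (hθ_law : ∀ i t, P.real {ω | (θ i ω : ℝ) ≤ t} = F₀.1 t) :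
    Differentiable ℝ (Screening.profit M) ∧
    (∀ F H, fderiv ℝ (Screening.profit M) F H = Screening.profit M H) ∧
    MemLp (fun τ => Screening.profit M (Screening.pointMass τ - F₀.1)) 2 (Screening.law F₀) ∧
    Screening.asymptoticVariance M F₀ =
      ∫ τ, (Screening.profit M (Screening.pointMass τ - F₀.1)) ^ 2 ∂(Screening.law F₀) ∧
    TendstoInDistribution
      (fun (n : ℕ) (ω : Ω) => √(n : ℝ) *
        (Screening.profit M (Screening.empiricalCDF fun i : Fin n => θ i ω) -
          Screening.profit M F₀.1))
      atTop id (fun _ => P)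
      (gaussianReal 0 (Screening.asymptoticVariance M F₀).toNNReal) := by
  open Screening in
  refine ⟨(profitCLM M).differentiable, fun F H => by rw [fderiv_profit, coe_profitCLM], ?_, ?_,
    ?_⟩
  · simp_rw [profit_pointMass_sub]
    exact (M.memLp_typeProfit _ 2).sub (memLp_const _)
  · simp_rw [asymptoticVariance, fderiv_profit, coe_profitCLM]
  have hlaw : ∀ i, P.map (θ i) = law F₀ := fun i => by
    have := Measure.isProbabilityMeasure_map (μ := P) (hθ_meas i).aemeasurable
    refine law_eq_of_real_le F₀ _ fun t => ?_
    exact (map_measureReal_apply (hθ_meas i) (measurable_subtype_coe measurableSet_Iic)).trans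
      (hθ_law i t)
  have hg := M.measurable_typeProfit
  have hident : ∀ i, IdentDistrib (θ i) (θ 0) P P := fun i =>
    ⟨(hθ_meas i).aemeasurable, (hθ_meas 0).aemeasurable, by rw [hlaw, hlaw]⟩
  have hmean : P[fun ω => M.typeProfit (θ 0 ω)] = profit M F₀.1 := by
    rw [profit_eq_integral, ← hlaw 0,
      integral_map (hθ_meas 0).aemeasurable hg.aestronglyMeasurable]
  have hvar : Var[fun ω => M.typeProfit (θ 0 ω); P] = asymptoticVariance M F₀ := by
    rw [asymptoticVariance_eq_variance, ← hlaw 0,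
      variance_map hg.aemeasurable (hθ_meas 0).aemeasurable]
    rfl
  -- The central limit theorem is applied to the profits from the sampled types, which are bounded
  -- and so square integrable.
  have hclt := tendstoInDistribution_inv_sqrt_mul_sum_sub (P := P)
    (P' := gaussianReal 0 (asymptoticVariance M F₀).toNNReal) (Y := id)
    (X := fun i ω => M.typeProfit (θ i ω)) ⟨aemeasurable_id, by rw [hvar, Measure.map_id]⟩
    (((hlaw 0).symm ▸ M.memLp_typeProfit (law F₀) 2 :
      MemLp (fun τ : Icc E.θlo E.θhi => M.typeProfit τ) 2 (P.map (θ 0))).comp_of_map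
        (hθ_meas 0).aemeasurable)
    (hθ_indep.comp (fun _ (τ : Icc E.θlo E.θhi) => M.typeProfit τ) fun _ => hg)
    (fun i => (hident i).comp hg)
  convert hclt using 3 with n ω
  rw [profit_empiricalCDF, hmean, Fin.sum_univ_eq_sum_range (fun i => M.typeProfit (θ i ω))]
  -- For `n = 0` both normalizations vanish, since `√0 = 0` and `0⁻¹ = 0`. Otherwise `√n / n = 1 /
  -- √n`.
  rcases n.eq_zero_or_pos with rfl | hn
  · simp
  have hn' : (0 : ℝ) < n := by exact_mod_cast hn
  have hs : √(n : ℝ) * √(n : ℝ) = n := Real.mul_self_sqrt hn'.le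
  have hs' : √(n : ℝ) ≠ 0 := (Real.sqrt_pos.2 hn').ne'
  field_simp
  rw [sq, hs]
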